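/- Let $D\ge 1$ and let $\Sigma$ be a finite nonempty set of $D\times D$ real matrices with nonnegative entries. For a matrix $A$ let $\|A\|=\max_{i,j}|A_{i,j}|$ and let $\rho(A)$ be its (ordinary) spectral radius, the largest modulus of a complex eigenvalue. For $n\ge 1$ put \[ \|\Sigma^n\|=\max_{A_1,\dots,A_n\in\Sigma}\|A_1\cdots A_n\|,\qquad P_n(\Sigma)=\max_{A_1,\dots,A_n\in\Sigma}\rho(A_1\cdots A_n). \] The dependency graph of $\Sigma$ is the directed graph on $\{1,\dots,D\}$ with an edge from $i$ to $j$ if and only if $A_{i,j}\neq 0$ for some $A\in\Sigma$ (loops are allowed). For a strongly connected component $C$ of it (a single vertex on no directed cycle counts as a component) put \[ \|\Sigma^n\|_C=\max_{A_1,\dots,A_n\in\Sigma}\ \max_{i,j\in C}|(A_1\cdots A_n)_{i,j}|. \] Then the limit $\lambda_C=\lim_{n\to\infty}\sqrt[n]{\|\Sigma^n\|_C}$ exists for every component $C$, and with $\lambda=\max_C\lambda_C$ the following hold. (i) There are constants $c_1,c_2>0$, depending only on $\Sigma$, such that for every $m\ge 1$ \[ c_1\lambda^m\ \le\ \max_{0\le\delta\le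 D}P_{m+\delta}(\Sigma)\ \le\ c_2\lambda^m . \] (ii) The limit $\lim_{n\to\infty}\sqrt[n]{\|\Sigma^n\|}$ exists, the sequence $\sqrt[n]{P_n(\Sigma)}$ is bounded, and \[ \limsup_{n\to\infty}\sqrt[n]{P_n(\Sigma)}=\lim_{n\to\infty}\sqrt[n]{\|\Sigma^n\|}=\lambda . \] -/

import Mathlib

namespace JSR

section Norm

attribute [local instance] Matrix.normedAddCommGroup

/-- The maximum norm of a matrix: the largest absolute value of an entry
(Mathlib's sup norm of sup norms). -/
noncomputable def maxNorm {D : ℕ} (A : Matrix (Fin D) (Fin D) ℝ) : ℝ := ‖A‖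

end Norm

/-- The spectral radius of a real matrix: the largest modulus of a complex eigenvalue. -/
noncomputable def specRadius {D : ℕ} (A : Matrix (Fin D) (Fin D) ℝ) : ℝ :=
  (spectralRadius ℂ (A.map Complex.ofReal)).toReal

variable {D : ℕ} (S : Finset (Matrix (Fin D) (Fin D) ℝ))

/-- The product `A₁ ⋯ Aₙ` of a sequence of `n` matrices from `S`. -/
def seqProd {n : ℕ} (A : Fin n → S) : Matrix (Fin D) (Fin D) ℝ :=
  (List.ofFn fun k => (A k : Matrix (Fin D) (Fin D) ℝ)).prod

/-- `‖Σⁿ‖`: the maximum of `‖A₁ ⋯ Aₙ‖` over `A₁, …, Aₙ ∈ S`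
(a supremum over the finite set of sequences). -/
noncomputable def normPow (n : ℕ) : ℝ := ⨆ A : Fin n → S, maxNorm (seqProd S A)

/-- `Pₙ(Σ)`: the maximum of the spectral radius of `A₁ ⋯ Aₙ` over `A₁, …, Aₙ ∈ S`. -/
noncomputable def maxSpecRadius (n : ℕ) : ℝ := ⨆ A : Fin n → S, specRadius (seqProd S A)

/-- The maximum of `P_{m+δ}(Σ)` over `0 ≤ δ ≤ D`. -/
noncomputable def windowMax (m : ℕ) : ℝ := ⨆ δ : Fin (D + 1), maxSpecRadius S (m + (δ : ℕ))

/-- The dependency graph: an edge (or loop) from `i` to `j` iff some matrix of `S`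
has a nonzero `(i, j)` entry. -/
def depGraph : Digraph (Fin D) where
  Adj i j := ∃ A ∈ S, A i j ≠ 0

/-- There is a directed path, possibly of length zero, from `i` to `j`. -/
def Reaches (i j : Fin D) : Prop := Relation.ReflTransGen (depGraph S).Adj i j

/-- A strongly connected component of the dependency graph: a class of mutually reachable
vertices. A vertex on no directed cycle is a component by itself. -/
def IsComponent (C : Set (Fin D)) : Prop :=
  ∃ i, C = {j | Reaches S i j ∧ Reaches S j i}

/-- `‖Σⁿ‖_C`: the largest absolute value of an entry of a product `A₁ ⋯ Aₙ` with both
indices in `C`. -/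
noncomputable def compNorm (C : Set (Fin D)) (n : ℕ) : ℝ :=
  ⨆ A : Fin n → S, ⨆ i : C, ⨆ j : C, |seqProd S A i j|

end JSR

/-! ### Root asymptotics of submultiplicative sequences. -/

section RootAsymptotics

open Filter Topology

/-! A path that leaves a strongly connected component never returns, so `D * compNorm` is
submultiplicative on a component. Fekete's lemma then gives the rate `L` of the component together
with `L ^ n ≤ D * compNorm S C n` (`IsComponent.exists_tendsto_compNorm`).

Upper bound: for `μ > lam` some length `N` makes all diagonal blocks small against `μ ^ N`. A weight
vector growing steeply along the order of components makes the off-diagonal blocks harmless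
(`exists_weight_mulVec_le`), so all products are `O(μ ^ n)`. Applied to the powers of a single
product, Gelfand's formula removes the constant, and `μ → lam` yields `maxSpecRadius S n ≤ lam ^ n`
exactly (`maxSpecRadius_le_pow`).

Lower bound: the largest entry of a component, at `(i, j)`, is multiplied by a product of length at
most `D` with `(j, i)` entry bounded below. This gives a large diagonal entry, and a diagonal entry
of a nonnegative matrix is at most its spectral radius (`exists_mul_compNorm_le_windowMax`). -/

theorem tendsto_const_rpow_one_div_natCast {K : ℝ} (hK : 0 < K) :
    Tendsto (fun n : ℕ => K ^ (1 / (n : ℝ))) atTop (𝓝 1) := by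
  have h := (Real.continuousAt_const_rpow (b := 0) hK.ne').tendsto.comp
    (tendsto_one_div_atTop_nhds_zero_nat (𝕜 := ℝ))
  rwa [Real.rpow_zero] at h

theorem mul_pow_rpow_one_div_natCast {K ν : ℝ} (hK : 0 ≤ K) (hν : 0 ≤ ν) {n : ℕ} (hn : n ≠ 0) :
    (K * ν ^ n) ^ (1 / (n : ℝ)) = K ^ (1 / (n : ℝ)) * ν := by
  rw [Real.mul_rpow hK (by positivity), one_div, Real.pow_rpow_inv_natCast hν hn]

/-- A sequence dominated by `K * ν ^ n` has `n`-th roots eventually below every `μ > ν`. -/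
theorem eventually_rpow_one_div_lt {u : ℕ → ℝ} (hu : ∀ n, 0 ≤ u n) {K ν μ : ℝ} (hK : 0 < K)
    (hν : 0 ≤ ν) (hνμ : ν < μ) (h : ∀ᶠ n in atTop, u n ≤ K * ν ^ n) :
    ∀ᶠ n : ℕ in atTop, u n ^ (1 / (n : ℝ)) < μ := by
  have h1 := (tendsto_const_rpow_one_div_natCast hK).mul_const ν
  rw [one_mul] at h1
  filter_upwards [h1.eventually_lt_const hνμ, h, eventually_ne_atTop 0] with n h2 h3 h4
  refine lt_of_le_of_lt ?_ h2
  rw [← mul_pow_rpow_one_div_natCast hK.le hν h4]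
  exact Real.rpow_le_rpow (hu n) h3 (by positivity)

/-- A submultiplicative sequence whose `N`-th term is at most `ν ^ N` is dominated by a multiple
of `ν ^ n`. -/
theorem exists_le_mul_pow_of_submultiplicative {u : ℕ → ℝ} (hu : ∀ n, 0 ≤ u n)
    (hmul : ∀ m n, u (m + n) ≤ u m * u n) {N : ℕ} (hN : N ≠ 0) {ν : ℝ} (hν : 0 < ν)
    (h : u N ≤ ν ^ N) : ∃ K > 0, ∀ n, u n ≤ K * ν ^ n := by
  have hq : ∀ q r, u (N * q + r) ≤ ν ^ (N * q) * u r := by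
    intro q r
    induction q with
    | zero => simp
    | succ q ih =>
      calc u (N * (q + 1) + r) = u (N + (N * q + r)) := by congr 1; ring
        _ ≤ u N * u (N * q + r) := hmul _ _
        _ ≤ ν ^ N * (ν ^ (N * q) * u r) := mul_le_mul h ih (hu _) (by positivity)
        _ = ν ^ (N * (q + 1)) * u r := by ring
  -- The sum dominates `u r / ν ^ r` for every remainder `r < N`; the `1` keeps the constant
  -- positive.
  refine ⟨1 + ∑ r ∈ Finset.range N, u r / ν ^ r,
    add_pos_of_pos_of_nonneg one_pos (Finset.sum_nonneg fun r _ => div_nonneg (hu r) (by positivity)),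
    fun n => ?_⟩
  have h1 : u (n % N) / ν ^ (n % N) ≤ 1 + ∑ r ∈ Finset.range N, u r / ν ^ r := by
    have := Finset.single_le_sum (f := fun r => u r / ν ^ r)
      (fun r _ => div_nonneg (hu r) (by positivity))
      (Finset.mem_range.2 (Nat.mod_lt n (Nat.pos_of_ne_zero hN)))
    linarith
  calc u n = u (N * (n / N) + n % N) := by rw [Nat.div_add_mod]
    _ ≤ ν ^ (N * (n / N)) * u (n % N) := hq _ _
    _ = u (n % N) / ν ^ (n % N) * ν ^ (N * (n / N) + n % N) := by
      rw [pow_add]; field_simp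
    _ ≤ _ := by rw [Nat.div_add_mod]; gcongr

/-- Fekete's lemma for nonnegative submultiplicative sequences. -/
theorem exists_tendsto_rpow_one_div_of_submultiplicative {u : ℕ → ℝ} (hu : ∀ n, 0 ≤ u n)
    (hmul : ∀ m n, u (m + n) ≤ u m * u n) :
    ∃ L, 0 ≤ L ∧ Tendsto (fun n : ℕ => u n ^ (1 / (n : ℝ))) atTop (𝓝 L) ∧
      ∀ n, n ≠ 0 → L ^ n ≤ u n := by
  -- The limit is the infimum of the roots over `n ≠ 0`, so `L ^ n ≤ u n` comes for free.
  set s : Set ℝ := (fun n : ℕ => u n ^ (1 / (n : ℝ))) '' {n | n ≠ 0} with hs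
  have hs0 : s.Nonempty := ⟨_, 1, one_ne_zero, rfl⟩
  have hsb : BddBelow s := ⟨0, by rintro _ ⟨n, -, rfl⟩; exact Real.rpow_nonneg (hu n) _⟩
  have hL0 : 0 ≤ sInf s := le_csInf hs0 (by rintro _ ⟨n, -, rfl⟩; exact Real.rpow_nonneg (hu n) _)
  have hle : ∀ n : ℕ, n ≠ 0 → sInf s ≤ u n ^ (1 / (n : ℝ)) := fun n hn => csInf_le hsb ⟨n, hn, rfl⟩
  have hroot : ∀ n : ℕ, n ≠ 0 → (u n ^ (1 / (n : ℝ))) ^ n = u n := fun n hn => by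
    rw [one_div, Real.rpow_inv_natCast_pow (hu n) hn]
  refine ⟨sInf s, hL0, ?_, fun n hn => ?_⟩
  · refine tendsto_order.2 ⟨fun a ha => ?_, fun μ hμ => ?_⟩
    · filter_upwards [eventually_ne_atTop 0] with n hn using ha.trans_le (hle n hn)
    · obtain ⟨_, ⟨N, hN, rfl⟩, hN'⟩ := exists_lt_of_csInf_lt hs0 hμ
      obtain ⟨ν, h1, h2⟩ := exists_between hN'
      have hx : 0 ≤ u N ^ (1 / (N : ℝ)) := Real.rpow_nonneg (hu N) _
      have hν : 0 < ν := lt_of_le_of_lt hx h1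
      obtain ⟨K, hK, hKu⟩ := exists_le_mul_pow_of_submultiplicative hu hmul hN hν
        (by rw [← hroot N hN]; exact pow_le_pow_left₀ hx h1.le N)
      exact eventually_rpow_one_div_lt hu hK hν.le h2 (Eventually.of_forall hKu)
  · rw [← hroot n hn]
    exact pow_le_pow_left₀ hL0 (hle n hn) n

end RootAsymptotics

namespace JSR

/-! ### Spectral radius and matrix entries via Gelfand's formula. -/

section SpectralRadius

open Filter Topology Matrix

attribute [local instance] Matrix.linftyOpNormedRing Matrix.linftyOpNormedAlgebra

variable {D : ℕ}

theorem specRadius_nonneg (A : Matrix (Fin D) (Fin D) ℝ) : 0 ≤ specRadius A :=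
  ENNReal.toReal_nonneg

/-- Gelfand's formula needs a Banach algebra norm; the row-sum norm is one, the maximum norm is not
submultiplicative. -/
theorem tendsto_norm_pow_specRadius (A : Matrix (Fin D) (Fin D) ℝ) :
    Tendsto (fun n : ℕ => ‖(A.map Complex.ofReal) ^ n‖ ^ (1 / (n : ℝ))) atTop
      (𝓝 (specRadius A)) := by
  have h := spectrum.pow_norm_pow_one_div_tendsto_nhds_spectralRadius (A.map Complex.ofReal)
  have hfin : spectralRadius ℂ (A.map Complex.ofReal) ≠ ⊤ := by
    refine (lt_of_le_of_lt (iSup₂_le fun k hk => ?_)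
      (ENNReal.coe_lt_top (r := ‖A.map Complex.ofReal‖₊ * ‖(1 : Matrix (Fin D) (Fin D) ℂ)‖₊))).ne
    exact_mod_cast spectrum.norm_le_norm_mul_of_mem hk
  refine ((ENNReal.tendsto_toReal hfin).comp h).congr fun n => ?_
  exact ENNReal.toReal_ofReal (Real.rpow_nonneg (norm_nonneg _) _)

theorem norm_pow_map_ofReal_apply (A : Matrix (Fin D) (Fin D) ℝ) (n : ℕ) (i j : Fin D) :
    ‖((A.map Complex.ofReal) ^ n) i j‖ = |(A ^ n) i j| := by
  have h : (A.map Complex.ofReal) ^ n = (A ^ n).map Complex.ofReal :=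
    (map_pow (RingHom.mapMatrix Complex.ofRealHom) A n).symm
  rw [h, Matrix.map_apply, Complex.norm_real, Real.norm_eq_abs]

theorem abs_pow_apply_le_norm (A : Matrix (Fin D) (Fin D) ℝ) (n : ℕ) (i j : Fin D) :
    |(A ^ n) i j| ≤ ‖(A.map Complex.ofReal) ^ n‖ := by
  rw [← norm_pow_map_ofReal_apply, Matrix.linfty_opNorm_def]
  have h1 := Finset.single_le_sum (f := fun j => ‖((A.map Complex.ofReal) ^ n) i j‖₊)
    (fun _ _ => zero_le) (Finset.mem_univ j)
  have h2 := Finset.le_sup (f := fun i => ∑ j, ‖((A.map Complex.ofReal) ^ n) i j‖₊)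
    (Finset.mem_univ i)
  exact_mod_cast h1.trans h2

theorem norm_pow_le_of_abs_apply_le (A : Matrix (Fin D) (Fin D) ℝ) (n : ℕ) {b : ℝ} (hb : 0 ≤ b)
    (h : ∀ i j, |(A ^ n) i j| ≤ b) : ‖(A.map Complex.ofReal) ^ n‖ ≤ D * b := by
  lift b to NNReal using hb
  rw [Matrix.linfty_opNorm_def]
  have : (Finset.univ.sup fun i => ∑ j, ‖((A.map Complex.ofReal) ^ n) i j‖₊) ≤ D * b := by
    refine Finset.sup_le fun i _ => ?_
    refine (Finset.sum_le_card_nsmul _ _ b fun j _ => ?_).trans (by simp)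
    exact_mod_cast (norm_pow_map_ofReal_apply A n i j).trans_le (h i j)
  exact_mod_cast this

theorem specRadius_le_of_abs_pow_apply_le (A : Matrix (Fin D) (Fin D) ℝ) {K μ : ℝ} (hK : 0 < K)
    (hμ : 0 ≤ μ) (h : ∀ n i j, |(A ^ n) i j| ≤ K * μ ^ n) : specRadius A ≤ μ := by
  refine le_of_forall_gt_imp_ge_of_dense fun ν hν => ?_
  refine le_of_tendsto (tendsto_norm_pow_specRadius A) ?_
  -- `D + 1` instead of `D` keeps the constant positive when `D = 0`.
  refine (eventually_rpow_one_div_lt (K := (D + 1) * K) (fun _ => norm_nonneg _) (by positivity)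
    hμ hν (Eventually.of_forall fun n => ?_)).mono fun _ => le_of_lt
  refine (norm_pow_le_of_abs_apply_le A n (by positivity) (h n)).trans ?_
  have : 0 ≤ K * μ ^ n := by positivity
  nlinarith

theorem pow_apply_self_le {A : Matrix (Fin D) (Fin D) ℝ} (hA : ∀ i j, 0 ≤ A i j) (i : Fin D)
    (n : ℕ) : (∀ j k, 0 ≤ (A ^ n) j k) ∧ A i i ^ n ≤ (A ^ n) i i := by
  induction n with
  | zero =>
    refine ⟨fun j k => ?_, by simp⟩
    rw [pow_zero, Matrix.one_apply]
    split_ifs <;> norm_num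
  | succ n ih =>
    refine ⟨fun j k => ?_, ?_⟩
    · rw [pow_succ, Matrix.mul_apply]
      exact Finset.sum_nonneg fun l _ => mul_nonneg (ih.1 j l) (hA l k)
    · rw [pow_succ, pow_succ, Matrix.mul_apply]
      exact (mul_le_mul_of_nonneg_right ih.2 (hA i i)).trans
        (Finset.single_le_sum (f := fun l => (A ^ n) i l * A l i)
          (fun l _ => mul_nonneg (ih.1 i l) (hA l i)) (Finset.mem_univ i))

/-- Repeating the loop at `i` gives `A i i ^ n ≤ (A ^ n) i i`; take roots in Gelfand's formula. -/
theorem apply_self_le_specRadius {A : Matrix (Fin D) (Fin D) ℝ} (hA : ∀ i j, 0 ≤ A i j)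
    (i : Fin D) : A i i ≤ specRadius A := by
  refine ge_of_tendsto (tendsto_norm_pow_specRadius A) ?_
  filter_upwards [eventually_ne_atTop 0] with n hn
  calc A i i = (A i i ^ n) ^ (1 / (n : ℝ)) := by rw [one_div, Real.pow_rpow_inv_natCast (hA i i) hn]
    _ ≤ _ := Real.rpow_le_rpow (pow_nonneg (hA i i) n)
      ((pow_apply_self_le hA i n).2.trans ((le_abs_self _).trans (abs_pow_apply_le_norm A n i i)))
      (by positivity)

end SpectralRadius

end JSR

namespace JSR

/-! ### Products of length `n` and growth within a component. -/

section Words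

open Matrix
open scoped Pointwise

variable {D : ℕ} {S : Finset (Matrix (Fin D) (Fin D) ℝ)}

/-- The products of `n` matrices from `S` are the elements of the pointwise power `S ^ n`. -/
theorem mem_pow_iff_exists_seqProd {n : ℕ} {M : Matrix (Fin D) (Fin D) ℝ} :
    M ∈ (S : Set (Matrix (Fin D) (Fin D) ℝ)) ^ n ↔ ∃ A : Fin n → S, seqProd S A = M :=
  Set.mem_pow

theorem seqProd_mem_pow {n : ℕ} (A : Fin n → S) :
    seqProd S A ∈ (S : Set (Matrix (Fin D) (Fin D) ℝ)) ^ n :=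
  mem_pow_iff_exists_seqProd.2 ⟨A, rfl⟩

theorem nonneg_of_mem_pow {s : Set (Matrix (Fin D) (Fin D) ℝ)}
    (hs : ∀ A ∈ s, ∀ i j, 0 ≤ A i j) {n : ℕ} :
    ∀ M ∈ s ^ n, ∀ i j, 0 ≤ M i j := by
  induction n with
  | zero =>
    rintro M hM i j
    rw [pow_zero, Set.mem_one] at hM
    rw [hM, Matrix.one_apply]
    split_ifs <;> norm_num
  | succ n ih =>
    rintro M hM i j
    rw [pow_succ] at hM
    obtain ⟨P, hP, Q, hQ, rfl⟩ := Set.mem_mul.1 hM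
    rw [Matrix.mul_apply]
    exact Finset.sum_nonneg fun l _ => mul_nonneg (ih P hP i l) (hs Q hQ l j)

theorem reaches_of_mem_pow {n : ℕ} :
    ∀ M ∈ (S : Set (Matrix (Fin D) (Fin D) ℝ)) ^ n, ∀ i j, M i j ≠ 0 → Reaches S i j := by
  induction n with
  | zero =>
    rintro M hM i j h
    rw [pow_zero, Set.mem_one] at hM
    rw [hM, Matrix.one_apply] at h
    obtain rfl : i = j := by by_contra hij; simp [hij] at h
    exact Relation.ReflTransGen.refl
  | succ n ih =>
    rintro M hM i j h
    rw [pow_succ] at hM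
    obtain ⟨P, hP, Q, hQ, rfl⟩ := Set.mem_mul.1 hM
    rw [Matrix.mul_apply] at h
    obtain ⟨l, -, hl⟩ := Finset.exists_ne_zero_of_sum_ne_zero h
    exact (ih P hP i l (left_ne_zero_of_mul hl)).tail ⟨Q, hQ, right_ne_zero_of_mul hl⟩

/-- If every matrix in `s` is nonnegative and contracts the weight vector `w` by `c`, then every
product of `n` of them contracts it by `c ^ n`. -/
theorem mulVec_le_of_mem_pow {s : Set (Matrix (Fin D) (Fin D) ℝ)}
    (hs : ∀ A ∈ s, ∀ i j, 0 ≤ A i j) {w : Fin D → ℝ} {c : ℝ} (hc : 0 ≤ c)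
    (h : ∀ A ∈ s, ∀ i, (A *ᵥ w) i ≤ c * w i) {n : ℕ} :
    ∀ M ∈ s ^ n, ∀ i, (M *ᵥ w) i ≤ c ^ n * w i := by
  induction n with
  | zero =>
    rintro M hM i
    rw [pow_zero, Set.mem_one] at hM
    simp [hM]
  | succ n ih =>
    rintro M hM i
    rw [pow_succ] at hM
    obtain ⟨P, hP, Q, hQ, rfl⟩ := Set.mem_mul.1 hM
    rw [← Matrix.mulVec_mulVec]
    calc (P *ᵥ (Q *ᵥ w)) i = ∑ l, P i l * (Q *ᵥ w) l := rfl
      _ ≤ ∑ l, P i l * (c * w l) := Finset.sum_le_sum fun l _ =>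
          mul_le_mul_of_nonneg_left (h Q hQ l) (nonneg_of_mem_pow hs P hP i l)
      _ = c * (P *ᵥ w) i := by
          rw [Matrix.mulVec, dotProduct, Finset.mul_sum]
          exact Finset.sum_congr rfl fun l _ => by ring
      _ ≤ c * (c ^ n * w i) := mul_le_mul_of_nonneg_left (ih P hP i) hc
      _ = c ^ (n + 1) * w i := by ring

theorem abs_apply_le_maxNorm (M : Matrix (Fin D) (Fin D) ℝ) (i j : Fin D) :
    |M i j| ≤ maxNorm M := by
  let _ := Matrix.normedAddCommGroup (m := Fin D) (n := Fin D) (α := ℝ)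
  exact Matrix.norm_entry_le_entrywise_sup_norm M

theorem maxNorm_le {M : Matrix (Fin D) (Fin D) ℝ} {b : ℝ} (hb : 0 ≤ b)
    (h : ∀ i j, |M i j| ≤ b) : maxNorm M ≤ b := by
  let _ := Matrix.normedAddCommGroup (m := Fin D) (n := Fin D) (α := ℝ)
  exact (Matrix.norm_le_iff hb).2 h

theorem abs_apply_le_normPow {n : ℕ} {M : Matrix (Fin D) (Fin D) ℝ}
    (hM : M ∈ (S : Set (Matrix (Fin D) (Fin D) ℝ)) ^ n) (i j : Fin D) :
    |M i j| ≤ normPow S n := by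
  obtain ⟨A, rfl⟩ := mem_pow_iff_exists_seqProd.1 hM
  exact (abs_apply_le_maxNorm _ i j).trans
    (le_ciSup (f := fun A : Fin n → S => maxNorm (seqProd S A)) (Set.finite_range _).bddAbove A)

theorem maxNorm_nonneg (M : Matrix (Fin D) (Fin D) ℝ) : 0 ≤ maxNorm M := by
  let _ := Matrix.normedAddCommGroup (m := Fin D) (n := Fin D) (α := ℝ)
  exact norm_nonneg M

theorem normPow_nonneg (n : ℕ) : 0 ≤ normPow S n :=
  Real.iSup_nonneg fun _ => maxNorm_nonneg _

theorem normPow_le {n : ℕ} {b : ℝ} (hb : 0 ≤ b)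
    (h : ∀ M ∈ (S : Set (Matrix (Fin D) (Fin D) ℝ)) ^ n, ∀ i j, |M i j| ≤ b) :
    normPow S n ≤ b :=
  Real.iSup_le (fun A => maxNorm_le hb (h _ (seqProd_mem_pow A))) hb

theorem maxSpecRadius_nonneg (n : ℕ) : 0 ≤ maxSpecRadius S n :=
  Real.iSup_nonneg fun _ => specRadius_nonneg _

theorem specRadius_le_maxSpecRadius {n : ℕ} {M : Matrix (Fin D) (Fin D) ℝ}
    (hM : M ∈ (S : Set (Matrix (Fin D) (Fin D) ℝ)) ^ n) :
    specRadius M ≤ maxSpecRadius S n := by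
  obtain ⟨A, rfl⟩ := mem_pow_iff_exists_seqProd.1 hM
  exact le_ciSup (f := fun A : Fin n → S => specRadius (seqProd S A))
    (Set.finite_range _).bddAbove A

theorem maxSpecRadius_le {n : ℕ} {b : ℝ} (hb : 0 ≤ b)
    (h : ∀ M ∈ (S : Set (Matrix (Fin D) (Fin D) ℝ)) ^ n, specRadius M ≤ b) :
    maxSpecRadius S n ≤ b :=
  Real.iSup_le (fun A => h _ (seqProd_mem_pow A)) hb

variable {C : Set (Fin D)}

theorem compNorm_nonneg (n : ℕ) : 0 ≤ compNorm S C n :=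
  Real.iSup_nonneg fun _ => Real.iSup_nonneg fun _ => Real.iSup_nonneg fun _ => abs_nonneg _

theorem abs_apply_le_compNorm {n : ℕ} {M : Matrix (Fin D) (Fin D) ℝ}
    (hM : M ∈ (S : Set (Matrix (Fin D) (Fin D) ℝ)) ^ n) {i j : Fin D} (hi : i ∈ C) (hj : j ∈ C) :
    |M i j| ≤ compNorm S C n := by
  obtain ⟨A, rfl⟩ := mem_pow_iff_exists_seqProd.1 hM
  refine le_trans ?_ (le_ciSup (f := fun A : Fin n → S => ⨆ i : C, ⨆ j : C, |seqProd S A i j|)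
    (Set.finite_range _).bddAbove A)
  refine le_trans ?_ (le_ciSup (f := fun i : C => ⨆ j : C, |seqProd S A i j|)
    (Set.finite_range _).bddAbove ⟨i, hi⟩)
  exact le_ciSup (f := fun j : C => |seqProd S A i j|) (Set.finite_range _).bddAbove ⟨j, hj⟩

theorem compNorm_le {n : ℕ} {b : ℝ} (hb : 0 ≤ b)
    (h : ∀ M ∈ (S : Set (Matrix (Fin D) (Fin D) ℝ)) ^ n, ∀ i ∈ C, ∀ j ∈ C, |M i j| ≤ b) :
    compNorm S C n ≤ b :=
  Real.iSup_le (fun A => Real.iSup_le (fun i => Real.iSup_le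
    (fun j => h _ (seqProd_mem_pow A) i i.2 j j.2) hb) hb) hb

theorem exists_abs_apply_eq_compNorm (hS : S.Nonempty) (hC : C.Nonempty) (n : ℕ) :
    ∃ M ∈ (S : Set (Matrix (Fin D) (Fin D) ℝ)) ^ n, ∃ i ∈ C, ∃ j ∈ C,
      |M i j| = compNorm S C n := by
  have := hS.to_subtype
  have := hC.to_subtype
  obtain ⟨A, hA⟩ := exists_eq_ciSup_of_finite
    (f := fun A : Fin n → S => ⨆ i : C, ⨆ j : C, |seqProd S A i j|)
  obtain ⟨i, hi⟩ := exists_eq_ciSup_of_finite (f := fun i : C => ⨆ j : C, |seqProd S A i j|)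
  obtain ⟨j, hj⟩ := exists_eq_ciSup_of_finite (f := fun j : C => |seqProd S A i j|)
  exact ⟨_, seqProd_mem_pow A, i, i.2, j, j.2, hj.trans (hi.trans hA)⟩

theorem compNorm_le_normPow (n : ℕ) : compNorm S C n ≤ normPow S n :=
  compNorm_le (normPow_nonneg n) fun _ hM i _ j _ => abs_apply_le_normPow hM i j

theorem IsComponent.nonempty (hC : IsComponent S C) : C.Nonempty := by
  obtain ⟨i, rfl⟩ := hC
  exact ⟨i, Relation.ReflTransGen.refl, Relation.ReflTransGen.refl⟩

theorem IsComponent.reaches (hC : IsComponent S C) {i j : Fin D} (hi : i ∈ C) (hj : j ∈ C) :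
    Reaches S i j := by
  obtain ⟨k, rfl⟩ := hC
  exact hi.2.trans hj.1

theorem IsComponent.mem_of_reaches (hC : IsComponent S C) {i j k : Fin D} (hi : i ∈ C)
    (hj : j ∈ C) (hik : Reaches S i k) (hkj : Reaches S k j) : k ∈ C := by
  obtain ⟨l, rfl⟩ := hC
  exact ⟨hi.1.trans hik, hkj.trans hj.2⟩

theorem isComponent_of_vertex (S : Finset (Matrix (Fin D) (Fin D) ℝ)) (i : Fin D) :
    IsComponent S {j | Reaches S i j ∧ Reaches S j i} :=
  ⟨i, rfl⟩

/-- A nonzero term `P i l * Q l j` puts `l` on a path between two vertices of `C`, hence in `C`; the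
factor `D` counts the choices of `l`. -/
theorem IsComponent.compNorm_add_le (hC : IsComponent S C) (m n : ℕ) :
    compNorm S C (m + n) ≤ D * (compNorm S C m * compNorm S C n) := by
  have h0 : 0 ≤ compNorm S C m * compNorm S C n :=
    mul_nonneg (compNorm_nonneg m) (compNorm_nonneg n)
  refine compNorm_le (mul_nonneg D.cast_nonneg h0) fun M hM i hi j hj => ?_
  rw [pow_add] at hM
  obtain ⟨P, hP, Q, hQ, rfl⟩ := Set.mem_mul.1 hM
  rw [Matrix.mul_apply]
  refine (Finset.abs_sum_le_sum_abs _ _).trans ?_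
  refine (Finset.sum_le_card_nsmul _ _ (compNorm S C m * compNorm S C n) fun l _ => ?_).trans
    (by simp)
  rw [abs_mul]
  by_cases hl : P i l = 0 ∨ Q l j = 0
  · rcases hl with hl | hl <;> simpa [hl] using h0
  · push Not at hl
    have hlC := hC.mem_of_reaches hi hj (reaches_of_mem_pow P hP i l hl.1)
      (reaches_of_mem_pow Q hQ l j hl.2)
    exact mul_le_mul (abs_apply_le_compNorm hP hi hlC) (abs_apply_le_compNorm hQ hlC hj)
      (abs_nonneg _) (compNorm_nonneg m)

open Filter Topology in
theorem IsComponent.exists_tendsto_compNorm (hD : 0 < D) (hC : IsComponent S C) :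
    ∃ L, 0 ≤ L ∧ Tendsto (fun n : ℕ => compNorm S C n ^ (1 / (n : ℝ))) atTop (𝓝 L) ∧
      (∀ n, n ≠ 0 → L ^ n ≤ D * compNorm S C n) ∧
      ∀ μ, L < μ → ∀ᶠ n in atTop, D * compNorm S C n ≤ μ ^ n := by
  have hD' : (0 : ℝ) < D := Nat.cast_pos.2 hD
  obtain ⟨L, hL, hlim, hle⟩ := exists_tendsto_rpow_one_div_of_submultiplicative
    (u := fun n => D * compNorm S C n) (fun n => mul_nonneg hD'.le (compNorm_nonneg n))
    (fun m n => by
      calc D * compNorm S C (m + n) ≤ D * (D * (compNorm S C m * compNorm S C n)) :=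
            mul_le_mul_of_nonneg_left (hC.compNorm_add_le m n) hD'.le
        _ = _ := by ring)
  refine ⟨L, hL, ?_, hle, fun μ hμ => ?_⟩
  swap
  · filter_upwards [hlim.eventually_lt_const hμ, eventually_ne_atTop 0] with n hn hn0
    have h0 : 0 ≤ D * compNorm S C n := mul_nonneg hD'.le (compNorm_nonneg n)
    rw [← Real.rpow_inv_natCast_pow h0 hn0, ← one_div]
    exact pow_le_pow_left₀ (Real.rpow_nonneg h0 _) hn.le n
  -- Remove the auxiliary factor `D`, whose `n`-th root tends to `1`.
  have h1 := hlim.div (tendsto_const_rpow_one_div_natCast hD') one_ne_zero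
  rw [div_one] at h1
  refine h1.congr fun n => ?_
  rw [Pi.div_apply, Real.mul_rpow hD'.le (compNorm_nonneg n),
    mul_div_cancel_left₀ _ (Real.rpow_pos_of_pos hD' _).ne']

end Words

end JSR

namespace JSR

/-! ### Upper bound by a weighted norm. -/

section UpperBound

open Matrix
open scoped Pointwise

variable {D : ℕ} {S : Finset (Matrix (Fin D) (Fin D) ℝ)}

/-- The number of vertices that can be reached from `i`. -/
noncomputable def reachCard (S : Finset (Matrix (Fin D) (Fin D) ℝ)) (i : Fin D) : ℕ :=
  {j | Reaches S i j}.ncard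

theorem reachCard_le_of_reaches {i j : Fin D} (h : Reaches S i j) :
    reachCard S j ≤ reachCard S i :=
  Set.ncard_le_ncard fun _ hk => h.trans hk

theorem reachCard_lt_of_reaches {i j : Fin D} (h : Reaches S i j) (h' : ¬ Reaches S j i) :
    reachCard S j < reachCard S i :=
  Set.ncard_lt_ncard ⟨fun _ hk => h.trans hk, fun hsub => h' (hsub Relation.ReflTransGen.refl)⟩

/-- A weight vector, increasing steeply along the order of components, that is contracted by
`ν` if all the diagonal blocks of the nonnegative matrices in `S ^ N` have entries at most
`ν / D`. -/
theorem exists_weight_mulVec_le (hD : 0 < D) (hnonneg : ∀ A ∈ S, ∀ i j, 0 ≤ A i j) {ν : ℝ}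
    (hν : 0 < ν) {N : ℕ} (h : ∀ C, IsComponent S C → D * compNorm S C N ≤ ν) :
    ∃ w : Fin D → ℝ, (∀ i, 1 ≤ w i) ∧
      ∀ M ∈ (S : Set (Matrix (Fin D) (Fin D) ℝ)) ^ N, ∀ i, (M *ᵥ w) i ≤ ν * w i := by
  have hD' : (0 : ℝ) < D := Nat.cast_pos.2 hD
  have hb : 0 ≤ D * normPow S N / ν := div_nonneg (mul_nonneg hD'.le (normPow_nonneg N)) hν.le
  -- Chosen so that one drop of `reachCard` pays for any entry: `D * normPow S N ≤ ν * t`.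
  set t : ℝ := 1 + D * normPow S N / ν with ht
  have ht1 : 1 ≤ t := by linarith
  have htν : D * normPow S N ≤ ν * t := by
    rw [ht, mul_add, mul_div_cancel₀ _ hν.ne']; linarith
  refine ⟨fun i => t ^ reachCard S i, fun i => one_le_pow₀ ht1, fun M hM i => ?_⟩
  have hM0 : ∀ i j, 0 ≤ M i j := nonneg_of_mem_pow (s := S) hnonneg M hM
  have key : ∀ j, D * (M i j * t ^ reachCard S j) ≤ ν * t ^ reachCard S i := by
    intro j
    by_cases hij : M i j = 0
    · rw [hij, zero_mul, mul_zero]; positivity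
    have hreach := reaches_of_mem_pow M hM i j hij
    -- Within a component the weights agree and `h` applies; otherwise `reachCard` drops strictly.
    by_cases hji : Reaches S j i
    · rw [le_antisymm (reachCard_le_of_reaches hreach) (reachCard_le_of_reaches hji), ← mul_assoc]
      have hC := isComponent_of_vertex S i
      have h1 := (le_abs_self (M i j)).trans (abs_apply_le_compNorm hM
        (C := {j | Reaches S i j ∧ Reaches S j i})
        ⟨Relation.ReflTransGen.refl, Relation.ReflTransGen.refl⟩ ⟨hreach, hji⟩)
      have h2 := (mul_le_mul_of_nonneg_left h1 hD'.le).trans (h _ hC)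
      gcongr
    · calc D * (M i j * t ^ reachCard S j) = D * M i j * t ^ reachCard S j := by ring
        _ ≤ (ν * t) * t ^ reachCard S j := by
          have h1 := (le_abs_self (M i j)).trans (abs_apply_le_normPow hM i j)
          have h2 := (mul_le_mul_of_nonneg_left h1 hD'.le).trans htν
          gcongr
        _ = ν * t ^ (reachCard S j + 1) := by ring
        _ ≤ _ := by
          have := reachCard_lt_of_reaches hreach hji
          gcongr
          exact this
  have hsum : D * (M *ᵥ fun i => t ^ reachCard S i) i ≤ D * (ν * t ^ reachCard S i) := by
    rw [Matrix.mulVec, dotProduct, Finset.mul_sum]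
    refine (Finset.sum_le_card_nsmul _ _ (ν * t ^ reachCard S i) fun j _ => key j).trans (by simp)
  exact le_of_mul_le_mul_left hsum hD'

/-- If the diagonal blocks of the products of length `N` are small compared with `μ ^ N`, then all
products grow at most like `μ ^ n`. -/
theorem exists_abs_apply_le_mul_pow (hD : 0 < D) (hnonneg : ∀ A ∈ S, ∀ i j, 0 ≤ A i j) {μ : ℝ}
    (hμ : 0 < μ) {N : ℕ} (hN : N ≠ 0) (h : ∀ C, IsComponent S C → D * compNorm S C N ≤ μ ^ N) :
    ∃ K > 0, ∀ n, ∀ M ∈ (S : Set (Matrix (Fin D) (Fin D) ℝ)) ^ n, ∀ i j,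
      |M i j| ≤ K * μ ^ n := by
  obtain ⟨w, hw, hwN⟩ := exists_weight_mulVec_le hD hnonneg (pow_pos hμ N) h
  have hw0 : ∀ i, 0 < w i := fun i => one_pos.trans_le (hw i)
  have hA0 : ∀ A ∈ S, ∀ i, 0 ≤ (A *ᵥ w) i := fun A hA i => by
    rw [Matrix.mulVec, dotProduct]
    exact Finset.sum_nonneg fun l _ => mul_nonneg (hnonneg A hA i l) (hw0 l).le
  -- `B` controls the `n % N` leftover factors; `μ ≤ B` lets `(B / μ) ^ (n % N)` be bounded by `(B /
  -- μ) ^ N`.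
  obtain ⟨B, hB, hBS⟩ : ∃ B, μ ≤ B ∧ ∀ A ∈ (S : Set (Matrix (Fin D) (Fin D) ℝ)),
      ∀ i, (A *ᵥ w) i ≤ B * w i := by
    have h0 : ∀ A ∈ S, ∀ i, 0 ≤ (A *ᵥ w) i / w i := fun A hA i => div_nonneg (hA0 A hA i) (hw0 i).le
    refine ⟨μ + ∑ A ∈ S, ∑ i, (A *ᵥ w) i / w i, ?_, fun A hA i => ?_⟩
    · exact le_add_of_nonneg_right
        (Finset.sum_nonneg fun A hA => Finset.sum_nonneg fun i _ => h0 A hA i)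
    · rw [← div_le_iff₀ (hw0 i)]
      have h1 := Finset.single_le_sum (f := fun i => (A *ᵥ w) i / w i)
        (fun i _ => h0 A hA i) (Finset.mem_univ i)
      have h2 := Finset.single_le_sum (f := fun A => ∑ i, (A *ᵥ w) i / w i)
        (fun A hA => Finset.sum_nonneg fun i _ => h0 A hA i) (Finset.mem_coe.1 hA)
      exact (h1.trans h2).trans (le_add_of_nonneg_left hμ.le)
  have hB0 : 0 < B := hμ.trans_le hB
  have : Nonempty (Fin D) := ⟨⟨0, hD⟩⟩
  obtain ⟨i₀, hi₀⟩ := Finite.exists_max w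
  have hBμ : 1 ≤ B / μ := (one_le_div hμ).2 hB
  refine ⟨(B / μ) ^ N * w i₀, mul_pos (by positivity) (hw0 i₀), fun n M hM i j => ?_⟩
  have hM0 : ∀ i j, 0 ≤ M i j := nonneg_of_mem_pow (s := S) hnonneg M hM
  rw [abs_of_nonneg (hM0 i j)]
  have hMw : (M *ᵥ w) i ≤ B ^ (n % N) * (μ ^ N) ^ (n / N) * w i := by
    rw [← Nat.div_add_mod n N, pow_add, pow_mul] at hM
    obtain ⟨P, hP, Q, hQ, rfl⟩ := Set.mem_mul.1 hM
    have hP0 : ∀ i j, 0 ≤ P i j :=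
      nonneg_of_mem_pow (nonneg_of_mem_pow (s := S) hnonneg) P hP
    rw [← Matrix.mulVec_mulVec]
    calc (P *ᵥ (Q *ᵥ w)) i = ∑ l, P i l * (Q *ᵥ w) l := rfl
      _ ≤ ∑ l, P i l * (B ^ (n % N) * w l) := Finset.sum_le_sum fun l _ =>
          mul_le_mul_of_nonneg_left (mulVec_le_of_mem_pow (s := S) hnonneg hB0.le hBS Q hQ l) (hP0 i l)
      _ = B ^ (n % N) * (P *ᵥ w) i := by
          rw [Matrix.mulVec, dotProduct, Finset.mul_sum]
          exact Finset.sum_congr rfl fun l _ => by ring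
      _ ≤ B ^ (n % N) * ((μ ^ N) ^ (n / N) * w i) :=
          mul_le_mul_of_nonneg_left (mulVec_le_of_mem_pow (nonneg_of_mem_pow (s := S) hnonneg)
            (by positivity) hwN P hP i) (by positivity)
      _ = _ := by ring
  have hmod : n % N ≤ N := (Nat.mod_lt n (Nat.pos_of_ne_zero hN)).le
  calc M i j ≤ M i j * w j := le_mul_of_one_le_right (hM0 i j) (hw j)
    _ ≤ (M *ᵥ w) i := Finset.single_le_sum (f := fun l => M i l * w l)
        (fun l _ => mul_nonneg (hM0 i l) (hw0 l).le) (Finset.mem_univ j)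
    _ ≤ B ^ (n % N) * (μ ^ N) ^ (n / N) * w i := hMw
    _ = (B / μ) ^ (n % N) * w i * μ ^ (N * (n / N) + n % N) := by
        rw [pow_add, ← pow_mul, div_pow]; field_simp
    _ = (B / μ) ^ (n % N) * w i * μ ^ n := by rw [Nat.div_add_mod]
    _ ≤ (B / μ) ^ N * w i₀ * μ ^ n := by
        have := hi₀ i
        have := (hw0 i).le
        gcongr

end UpperBound

/-! ### Lower bound by short return paths. -/

section ReturnPaths

open scoped Pointwise

/-- In a layered relation where every vertex first reached at time `n + 1` has a predecessor
reached at time `n`, a vertex first reached at time `n` forces more than `n` vertices. -/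
theorem lt_card_of_minimal_time {V : Type*} [Fintype V] {P : ℕ → V → Prop}
    (hstep : ∀ n j, P (n + 1) j → ∃ k, P n k ∧ ∀ m, P m k → P (m + 1) j) {n : ℕ} {j : V}
    (hj : P n j) (hmin : ∀ m < n, ¬ P m j) : n < Fintype.card V := by
  have key : ∀ n j, P n j → (∀ m < n, ¬ P m j) → ∀ k ≤ n, ∃ v, P k v ∧ ∀ m < k, ¬ P m v := by
    intro n
    induction n with
    | zero =>
      intro j hj hmin k hk
      obtain rfl := Nat.le_zero.1 hk
      exact ⟨j, hj, hmin⟩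
    | succ n ih =>
      intro j hj hmin k hk
      rcases hk.eq_or_lt with rfl | hk
      · exact ⟨j, hj, hmin⟩
      -- An earlier visit to `l` would give an earlier visit to `j`, so `n` is the first time of
      -- `l`.
      · obtain ⟨l, hl, hlj⟩ := hstep n j hj
        exact ih l hl (fun m hm h => hmin (m + 1) (by omega) (hlj m h)) k (by omega)
  choose v hv hvmin using fun k : Fin (n + 1) => key n j hj hmin k (by omega)
  have hinj : Function.Injective v := by
    intro a b hab
    have h1 : ¬ (a : ℕ) < b := fun h => hvmin b a h (hab ▸ hv a)
    have h2 : ¬ (b : ℕ) < a := fun h => hvmin a b h (hab ▸ hv b)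
    exact Fin.ext (by omega)
  simpa using Fintype.card_le_of_injective v hinj

variable {D : ℕ} {S : Finset (Matrix (Fin D) (Fin D) ℝ)}

theorem mul_apply_pos {P Q : Matrix (Fin D) (Fin D) ℝ} (hP : ∀ i j, 0 ≤ P i j)
    (hQ : ∀ i j, 0 ≤ Q i j) {i k j : Fin D} (h : 0 < P i k) (h' : 0 < Q k j) :
    0 < (P * Q) i j := by
  rw [Matrix.mul_apply]
  exact Finset.sum_pos' (fun l _ => mul_nonneg (hP i l) (hQ l j))
    ⟨k, Finset.mem_univ k, mul_pos h h'⟩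

/-- By nonnegativity nothing cancels, so paths yield positive entries; the first time at which `j`
is reached is below `D`. -/
theorem exists_mem_pow_apply_pos (hnonneg : ∀ A ∈ S, ∀ i j, 0 ≤ A i j) {i j : Fin D}
    (h : Reaches S i j) :
    ∃ n ≤ D, ∃ M ∈ (S : Set (Matrix (Fin D) (Fin D) ℝ)) ^ n, 0 < M i j := by
  classical
  set P : ℕ → Fin D → Prop := fun n k =>
    ∃ M ∈ (S : Set (Matrix (Fin D) (Fin D) ℝ)) ^ n, 0 < M i k with hP
  have hadd : ∀ A ∈ S, ∀ k l, 0 < A k l → ∀ m, P m k → P (m + 1) l := by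
    rintro A hA k l hkl m ⟨M, hM, hMk⟩
    refine ⟨M * A, ?_, mul_apply_pos (nonneg_of_mem_pow (s := S) hnonneg M hM) (hnonneg A hA) hMk hkl⟩
    rw [pow_succ]
    exact Set.mul_mem_mul hM hA
  have hex : ∃ n, P n j := by
    induction h with
    | refl => exact ⟨0, 1, by rw [pow_zero]; exact Set.mem_one.2 rfl, by simp⟩
    | tail _ hkl ih =>
      obtain ⟨n, hn⟩ := ih
      obtain ⟨A, hA, hAkl⟩ := hkl
      exact ⟨n + 1, hadd A hA _ _ (lt_of_le_of_ne (hnonneg A hA _ _) hAkl.symm) n hn⟩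
  refine ⟨Nat.find hex, ?_, Nat.find_spec hex⟩
  have hlt := lt_card_of_minimal_time (P := P) ?_ (Nat.find_spec hex) fun m hm => Nat.find_min hex hm
  · simpa using hlt.le
  · rintro n l ⟨M, hM, hMl⟩
    rw [pow_succ] at hM
    obtain ⟨Q, hQ, A, hA, rfl⟩ := Set.mem_mul.1 hM
    have hQ0 := nonneg_of_mem_pow (s := S) hnonneg Q hQ
    rw [Matrix.mul_apply] at hMl
    obtain ⟨k, -, hk⟩ := Finset.exists_ne_zero_of_sum_ne_zero hMl.ne'
    exact ⟨k, ⟨Q, hQ, lt_of_le_of_ne (hQ0 i k) (left_ne_zero_of_mul hk).symm⟩,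
      hadd A hA k l (lt_of_le_of_ne (hnonneg A hA k l) (right_ne_zero_of_mul hk).symm)⟩

theorem exists_pos_le_apply_of_reaches (hD : 0 < D) (hnonneg : ∀ A ∈ S, ∀ i j, 0 ≤ A i j) :
    ∃ c > 0, ∀ i j, Reaches S i j →
      ∃ n ≤ D, ∃ M ∈ (S : Set (Matrix (Fin D) (Fin D) ℝ)) ^ n, c ≤ M i j := by
  have h : ∀ p : Fin D × Fin D, ∃ c > (0 : ℝ), Reaches S p.1 p.2 →
      ∃ n ≤ D, ∃ M ∈ (S : Set (Matrix (Fin D) (Fin D) ℝ)) ^ n, c ≤ M p.1 p.2 := by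
    intro p
    by_cases hp : Reaches S p.1 p.2
    · obtain ⟨n, hn, M, hM, hpos⟩ := exists_mem_pow_apply_pos hnonneg hp
      exact ⟨_, hpos, fun _ => ⟨n, hn, M, hM, le_rfl⟩⟩
    -- Unreachable pairs get a dummy value, so that a minimum over all pairs can be taken.
    · exact ⟨1, one_pos, fun h => absurd h hp⟩
  choose c hc h using h
  have : Nonempty (Fin D × Fin D) := ⟨(⟨0, hD⟩, ⟨0, hD⟩)⟩
  obtain ⟨p, hp⟩ := Finite.exists_min c
  refine ⟨c p, hc p, fun i j hij => ?_⟩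
  obtain ⟨n, hn, M, hM, hle⟩ := h (i, j) hij
  exact ⟨n, hn, M, hM, (hp (i, j)).trans hle⟩

theorem maxSpecRadius_le_windowMax (m : ℕ) {δ : ℕ} (hδ : δ ≤ D) :
    maxSpecRadius S (m + δ) ≤ windowMax S m :=
  le_ciSup (f := fun δ : Fin (D + 1) => maxSpecRadius S (m + (δ : ℕ)))
    (Set.finite_range _).bddAbove ⟨δ, Nat.lt_succ_of_le hδ⟩

/-- Closing up an optimal path in a component by a short return path bounds the spectral radii in
a window from below. -/
theorem exists_mul_compNorm_le_windowMax (hD : 0 < D) (hS : S.Nonempty)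
    (hnonneg : ∀ A ∈ S, ∀ i j, 0 ≤ A i j) :
    ∃ c > 0, ∀ C, IsComponent S C → ∀ m, c * compNorm S C m ≤ windowMax S m := by
  obtain ⟨c, hc, h⟩ := exists_pos_le_apply_of_reaches hD hnonneg
  refine ⟨c, hc, fun C hC m => ?_⟩
  obtain ⟨P, hP, i, hi, j, hj, hPij⟩ := exists_abs_apply_eq_compNorm hS hC.nonempty m
  obtain ⟨δ, hδ, Q, hQ, hQji⟩ := h j i (hC.reaches hj hi)
  have hP0 := nonneg_of_mem_pow (s := S) hnonneg P hP
  have hQ0 := nonneg_of_mem_pow (s := S) hnonneg Q hQ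
  have hPQ : P * Q ∈ (S : Set (Matrix (Fin D) (Fin D) ℝ)) ^ (m + δ) := by
    rw [pow_add]; exact Set.mul_mem_mul hP hQ
  rw [← hPij, abs_of_nonneg (hP0 i j)]
  calc c * P i j ≤ P i j * Q j i := by
        rw [mul_comm]; exact mul_le_mul_of_nonneg_left hQji (hP0 i j)
    _ ≤ (P * Q) i i := by
        rw [Matrix.mul_apply]
        exact Finset.single_le_sum (f := fun l => P i l * Q l i)
          (fun l _ => mul_nonneg (hP0 i l) (hQ0 l i)) (Finset.mem_univ j)
    _ ≤ specRadius (P * Q) :=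
        apply_self_le_specRadius (nonneg_of_mem_pow (s := S) hnonneg _ hPQ) i
    _ ≤ maxSpecRadius S (m + δ) := specRadius_le_maxSpecRadius hPQ
    _ ≤ windowMax S m := maxSpecRadius_le_windowMax m hδ

end ReturnPaths

end JSR

namespace JSR

/-! ### Comparison of the growth rates. -/

section GrowthRate

open Filter Topology
open scoped Pointwise

variable {D : ℕ} {S : Finset (Matrix (Fin D) (Fin D) ℝ)} {lam : ℝ}

/-- If `lam` bounds the growth rates of all components, then all products grow at most like
`μ ^ n` for every `μ > lam`. -/
theorem exists_abs_apply_le_mul_pow_of_lt (hD : 0 < D) (hnonneg : ∀ A ∈ S, ∀ i j, 0 ≤ A i j)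
    (hlam : 0 ≤ lam) (h : ∀ C, IsComponent S C → ∀ μ, lam < μ →
      ∀ᶠ n in atTop, D * compNorm S C n ≤ μ ^ n) {μ : ℝ} (hμ : lam < μ) :
    ∃ K > 0, ∀ n, ∀ M ∈ (S : Set (Matrix (Fin D) (Fin D) ℝ)) ^ n, ∀ i j,
      |M i j| ≤ K * μ ^ n := by
  have hall : ∀ᶠ n in atTop, ∀ C, IsComponent S C → D * compNorm S C n ≤ μ ^ n := by
    rw [eventually_all]
    intro C
    by_cases hC : IsComponent S C
    · exact (h C hC μ hμ).mono fun _ hn _ => hn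
    · exact Eventually.of_forall fun _ hC' => absurd hC' hC
  obtain ⟨N, hN, hN0⟩ := (hall.and (eventually_ne_atTop 0)).exists
  exact exists_abs_apply_le_mul_pow hD hnonneg (hlam.trans_lt hμ) hN0 hN

/-- Powers `M ^ k` are products of length `n * k`, with entries at most `K * (μ ^ n) ^ k`; hence the
spectral radius of `M` is at most `μ ^ n`, without `K`. -/
theorem maxSpecRadius_le_pow (hlam : 0 ≤ lam) (h : ∀ μ, lam < μ → ∃ K > 0, ∀ n,
      ∀ M ∈ (S : Set (Matrix (Fin D) (Fin D) ℝ)) ^ n, ∀ i j, |M i j| ≤ K * μ ^ n) (n : ℕ) :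
    maxSpecRadius S n ≤ lam ^ n := by
  refine maxSpecRadius_le (pow_nonneg hlam n) fun M hM => ?_
  refine ge_of_tendsto (((continuous_pow n).tendsto lam).mono_left nhdsWithin_le_nhds)
    (eventually_mem_nhdsWithin (s := Set.Ioi lam) |>.mono fun μ hμ => ?_)
  obtain ⟨K, hK, hle⟩ := h μ hμ
  have hμ0 : 0 ≤ μ := hlam.trans (le_of_lt hμ)
  refine specRadius_le_of_abs_pow_apply_le M hK (pow_nonneg hμ0 n) fun k i j => ?_
  rw [← pow_mul]
  refine hle (n * k) _ ?_ i j
  rw [pow_mul]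
  exact Set.pow_mem_pow hM

theorem pow_le_max_one_pow (hlam : 0 ≤ lam) {δ : ℕ} (hδ : δ ≤ D) :
    lam ^ δ ≤ max 1 lam ^ D :=
  (pow_le_pow_left₀ hlam (le_max_right 1 lam) δ).trans (pow_le_pow_right₀ (le_max_left 1 lam) hδ)

theorem windowMax_le_mul_pow (hlam : 0 ≤ lam) (h : ∀ n, maxSpecRadius S n ≤ lam ^ n) (m : ℕ) :
    windowMax S m ≤ max 1 lam ^ D * lam ^ m := by
  refine ciSup_le fun δ => (h _).trans ?_
  rw [pow_add, mul_comm]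
  exact mul_le_mul_of_nonneg_right (pow_le_max_one_pow hlam (Nat.le_of_lt_succ δ.2))
    (pow_nonneg hlam m)

theorem tendsto_normPow (hlam : 0 ≤ lam) (h : ∀ μ, lam < μ → ∃ K > 0, ∀ n,
      ∀ M ∈ (S : Set (Matrix (Fin D) (Fin D) ℝ)) ^ n, ∀ i j, |M i j| ≤ K * μ ^ n)
    {C : Set (Fin D)}
    (hC : Tendsto (fun n : ℕ => compNorm S C n ^ (1 / (n : ℝ))) atTop (𝓝 lam)) :
    Tendsto (fun n : ℕ => normPow S n ^ (1 / (n : ℝ))) atTop (𝓝 lam) := by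
  refine tendsto_order.2 ⟨fun a ha => ?_, fun μ hμ => ?_⟩
  · filter_upwards [hC.eventually_const_lt ha] with n hn
    exact hn.trans_le
      (Real.rpow_le_rpow (compNorm_nonneg n) (compNorm_le_normPow n) (by positivity))
  · obtain ⟨ν, h1, h2⟩ := exists_between hμ
    obtain ⟨K, hK, hle⟩ := h ν h1
    have hν : 0 ≤ ν := hlam.trans h1.le
    exact eventually_rpow_one_div_lt normPow_nonneg hK hν h2
      (Eventually.of_forall fun n => normPow_le (by positivity) (hle n))

theorem eventually_maxSpecRadius_rpow_le (hlam : 0 ≤ lam)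
    (h : ∀ n, maxSpecRadius S n ≤ lam ^ n) :
    ∀ᶠ n : ℕ in atTop, maxSpecRadius S n ^ (1 / (n : ℝ)) ≤ lam := by
  filter_upwards [eventually_ne_atTop 0] with n hn
  rw [← Real.pow_rpow_inv_natCast hlam hn, ← one_div]
  exact Real.rpow_le_rpow (maxSpecRadius_nonneg n) (h n) (by positivity)

theorem limsup_maxSpecRadius (hlam : 0 ≤ lam) (h : ∀ n, maxSpecRadius S n ≤ lam ^ n) {c : ℝ}
    (hc : 0 < c) (hlow : ∀ m, 1 ≤ m → c * lam ^ m ≤ windowMax S m) :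
    limsup (fun n : ℕ => maxSpecRadius S n ^ (1 / (n : ℝ))) atTop = lam := by
  have hup := eventually_maxSpecRadius_rpow_le hlam h
  have hbdd : IsBoundedUnder (· ≤ ·) atTop (fun n : ℕ => maxSpecRadius S n ^ (1 / (n : ℝ))) :=
    ⟨lam, eventually_map.2 hup⟩
  have hcobdd : IsCoboundedUnder (· ≤ ·) atTop
      (fun n : ℕ => maxSpecRadius S n ^ (1 / (n : ℝ))) :=
    (isBoundedUnder_of ⟨0, fun n => Real.rpow_nonneg (maxSpecRadius_nonneg n) _⟩ :
      IsBoundedUnder (· ≥ ·) atTop _).isCoboundedUnder_le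
  refine le_antisymm (limsup_le_of_le hcobdd hup) (le_of_forall_lt_imp_le_of_dense fun a ha => ?_)
  have hmax : 0 < max 1 lam ^ D := pow_pos (one_pos.trans_le (le_max_left 1 lam)) D
  set c' : ℝ := c / max 1 lam ^ D with hc'
  have hc'0 : 0 < c' := div_pos hc hmax
  -- Each window contains a length `N + 1 + δ` attaining its maximum; dividing by `max 1 lam ^ D`
  -- absorbs `lam ^ δ`.
  have hfreq : ∃ᶠ n in atTop, c' * lam ^ n ≤ maxSpecRadius S n := by
    refine frequently_atTop.2 fun N => ?_
    obtain ⟨δ, hδ⟩ := exists_eq_ciSup_of_finite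
      (f := fun δ : Fin (D + 1) => maxSpecRadius S (N + 1 + (δ : ℕ)))
    refine ⟨N + 1 + δ, by omega, ?_⟩
    calc c' * lam ^ (N + 1 + (δ : ℕ)) = c' * lam ^ (δ : ℕ) * lam ^ (N + 1) := by ring
      _ ≤ c' * max 1 lam ^ D * lam ^ (N + 1) := by
          have := pow_le_max_one_pow hlam (Nat.le_of_lt_succ δ.2)
          gcongr
      _ = c * lam ^ (N + 1) := by rw [hc', div_mul_cancel₀ _ hmax.ne']
      _ ≤ windowMax S (N + 1) := hlow _ (by omega)
      _ = _ := hδ.symm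
  have hlim := (tendsto_const_rpow_one_div_natCast hc'0).mul_const lam
  rw [one_mul] at hlim
  refine le_limsup_of_frequently_le ((hfreq.and_eventually
    ((hlim.eventually_const_lt ha).and (eventually_ne_atTop 0))).mono ?_) hbdd
  rintro n ⟨h1, h2, h3⟩
  refine h2.le.trans ?_
  rw [← mul_pow_rpow_one_div_natCast hc'0.le hlam h3]
  exact Real.rpow_le_rpow (by positivity) h1 (by positivity)

end GrowthRate

end JSR

theorem mainTheorem5 {D : ℕ} (hD : 0 < D) (S : Finset (Matrix (Fin D) (Fin D) ℝ))
    (hS : S.Nonempty) (hnonneg : ∀ A ∈ S, ∀ i j, 0 ≤ A i j) :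
    ∃ (lamC : Set (Fin D) → ℝ) (lam : ℝ),
      (∀ C, JSR.IsComponent S C →
        Filter.Tendsto (fun n : ℕ => JSR.compNorm S C n ^ (1 / (n : ℝ))) Filter.atTop
          (nhds (lamC C))) ∧
      IsGreatest {x | ∃ C, JSR.IsComponent S C ∧ x = lamC C} lam ∧
      (∃ c₁ > 0, ∃ c₂ > 0, ∀ m : ℕ, 1 ≤ m →
        c₁ * lam ^ m ≤ JSR.windowMax S m ∧ JSR.windowMax S m ≤ c₂ * lam ^ m) ∧
      Filter.Tendsto (fun n : ℕ => JSR.normPow S n ^ (1 / (n : ℝ))) Filter.atTop (nhds lam) ∧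
      Filter.IsBoundedUnder (· ≤ ·) Filter.atTop
        (fun n : ℕ => JSR.maxSpecRadius S n ^ (1 / (n : ℝ))) ∧
      Filter.limsup (fun n : ℕ => JSR.maxSpecRadius S n ^ (1 / (n : ℝ))) Filter.atTop = lam := by
  have hex : ∀ C, ∃ L, JSR.IsComponent S C → 0 ≤ L ∧
      Filter.Tendsto (fun n : ℕ => JSR.compNorm S C n ^ (1 / (n : ℝ))) Filter.atTop (nhds L) ∧
      (∀ n, n ≠ 0 → L ^ n ≤ D * JSR.compNorm S C n) ∧
      ∀ μ, L < μ → ∀ᶠ n in Filter.atTop, D * JSR.compNorm S C n ≤ μ ^ n := by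
    intro C
    by_cases hC : JSR.IsComponent S C
    · obtain ⟨L, hL⟩ := hC.exists_tendsto_compNorm hD
      exact ⟨L, fun _ => hL⟩
    · exact ⟨0, fun h => absurd h hC⟩
  choose lamC hlamC using hex
  -- A component of maximal rate: its rate is `lam`, and it alone supplies the lower bounds.
  obtain ⟨C, hC, hmax⟩ := Set.exists_max_image {C | JSR.IsComponent S C} lamC
    (Set.toFinite _) ⟨_, JSR.isComponent_of_vertex S ⟨0, hD⟩⟩
  obtain ⟨hlam, hlim, hpow, -⟩ := hlamC C hC
  have hgrowth := fun μ => JSR.exists_abs_apply_le_mul_pow_of_lt (μ := μ) hD hnonneg hlam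
    fun C' hC' μ hμ => (hlamC C' hC').2.2.2 μ ((hmax C' hC').trans_lt hμ)
  have hspec := JSR.maxSpecRadius_le_pow hlam hgrowth
  obtain ⟨c, hc, hwin⟩ := JSR.exists_mul_compNorm_le_windowMax hD hS hnonneg
  have hD' : (0 : ℝ) < D := Nat.cast_pos.2 hD
  have hlow : ∀ m, 1 ≤ m → c / D * lamC C ^ m ≤ JSR.windowMax S m := by
    intro m hm
    refine le_trans ?_ (hwin C hC m)
    rw [div_mul_eq_mul_div, div_le_iff₀ hD', mul_assoc, mul_comm _ (D : ℝ)]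
    exact mul_le_mul_of_nonneg_left (hpow m (by omega)) hc.le
  refine ⟨lamC, lamC C, fun C' hC' => (hlamC C' hC').2.1, ⟨⟨C, hC, rfl⟩, ?_⟩,
    ⟨c / D, div_pos hc hD', max 1 (lamC C) ^ D,
      pow_pos (one_pos.trans_le (le_max_left 1 (lamC C))) D,
      fun m hm => ⟨hlow m hm, JSR.windowMax_le_mul_pow hlam hspec m⟩⟩,
    JSR.tendsto_normPow hlam hgrowth hlim,
    ⟨lamC C, Filter.eventually_map.2 (JSR.eventually_maxSpecRadius_rpow_le hlam hspec)⟩,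
    JSR.limsup_maxSpecRadius hlam hspec (div_pos hc hD') hlow⟩
  rintro _ ⟨C', hC', rfl⟩
  exact hmax C' hC'
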